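/- Let $d\ge 1$, let $p,q\in[1,\infty)$ with $q\ne p$, and let $\mu,\nu$ be Borel probability measures on $\mathbb R^d$ with finite moments of order $p$. For $i=1,\dots,d$ let $F_i$ and $G_i$ be the distribution functions of the $i$-th one-dimensional margins of $\mu$ and $\nu$. Assume that $\mu$ and $\nu$ share a copula, i.e. there is a $d$-dimensional copula $C:[0,1]^d\to[0,1]$ (a grounded, $d$-increasing function with uniform margins) such that the joint distribution functions of $\mu$ and $\nu$ are $H_\mu(x)=C(F_1(x_1),\dots,F_d(x_d))$ and $H_\nu(y)=C(G_1(y_1),\dots,G_d(y_d))$ for all $x,y\in\mathbb R^d$. Define the Wasserstein distance $W_{p,q}$ by $$W_{p,q}(\mu,\nu)^p=\inf_{\pi}\int_{\mathbb R^d\times\mathbb R^d}\|x-y\|_q^p\,\pi(dx,dy),$$ where $\pi$ ranges over all couplings of $\mu$ and $\nu$, and put $$S=\sum_{i=1}^d\int_{\mathbb R}\int_{\mathbb R}|x_i-y_i|^p\,dM(F_i(x_i),G_i(y_i)),\qquad M(u,v)=\min(u,v),$$ where $dM(F_i(x_i),G_i(y_i))$ denotes the probability measure on $\mathbb R^2$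 with joint distribution function $(x,y)\mapsto M(F_i(x),G_i(y))$. Then $S<\infty$, and: 1. if $q\le p$, then $S\le W_{p,q}(\mu,\nu)^p\le d^{\frac pq-1}S$; 2. if $p\le q$, then $d^{\frac pq-1}S\le W_{p,q}(\mu,\nu)^p\le S$. -/

import Mathlib

open MeasureTheory ProbabilityTheory Set
open scoped ENNReal unitInterval

noncomputable section

/-! ### Copulas -/

/-- A function `C : [0,1]^d → [0,1]` is a `d`-dimensional copula if it is grounded, `d`-increasing
and has uniform margins. In the alternating sum over the vertices of the box `[a, b]`, the set `s`
collects the coordinates at which the lower endpoint is taken. -/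
structure IsCopula {d : ℕ} (C : (Fin d → I) → I) : Prop where
  grounded : ∀ u : Fin d → I, (∃ i, u i = 0) → C u = 0
  increasing : ∀ a b : Fin d → I, (∀ i, a i ≤ b i) →
    0 ≤ ∑ s : Finset (Fin d), (-1 : ℝ) ^ s.card * (C (fun i => if i ∈ s then a i else b i) : ℝ)
  uniform_margins : ∀ (i : Fin d) (t : I), C (Function.update (fun _ => 1) i t) = t

/-- The comonotonicity copula `M(u₁, …, u_d) = min(u₁, …, u_d)`. -/
def comonotonicityCopula {d : ℕ} (u : Fin d → I) : I := Finset.univ.inf u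

/-- The distribution function `F i` of the `i`-th one-dimensional margin of `μ`, as a function with
values in `[0,1]`. -/
def marginCDF {d : ℕ} (μ : Measure (Fin d → ℝ)) (i : Fin d) (x : ℝ) : I :=
  ⟨cdf (μ.map (fun z => z i)) x, cdf_nonneg _ x, cdf_le_one _ x⟩

/-- The joint distribution function `H(x₁, …, x_d) = μ((-∞, x₁] × ⋯ × (-∞, x_d])`. -/
def jointCDF {d : ℕ} (μ : Measure (Fin d → ℝ)) (x : Fin d → ℝ) : ℝ :=
  μ.real {z | ∀ i, z i ≤ x i}

/-- `μ` and `ν` share a copula: a single copula links both joint distribution functions to the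
respective margins. -/
def ShareCopula {d : ℕ} (μ ν : Measure (Fin d → ℝ)) : Prop :=
  ∃ C : (Fin d → I) → I, IsCopula C ∧
    (∀ x, jointCDF μ x = C (fun i => marginCDF μ i (x i))) ∧
    (∀ y, jointCDF ν y = C (fun i => marginCDF ν i (y i)))

/-! ### Wasserstein distances -/

/-- The norm `‖x‖_q` on `ℝ^d`. -/
def qNorm {d : ℕ} (q : ℝ) (x : Fin d → ℝ) : ℝ := ‖WithLp.toLp (ENNReal.ofReal q) x‖

/-- Finiteness of the moment of order `p`. A probability measure on `ℝ^d` belongs to the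
Wasserstein space of order `p` if and only if it has this property. -/
def FiniteMoment {d : ℕ} (p : ℝ) (μ : Measure (Fin d → ℝ)) : Prop :=
  ∃ x₀ : Fin d → ℝ, ∫⁻ x, ENNReal.ofReal (qNorm p (x₀ - x) ^ p) ∂μ < ∞

/-- The couplings of `μ` and `ν`: probability measures on the product with margins `μ`, `ν`. -/
def couplings {X : Type*} [MeasurableSpace X] (μ ν : Measure X) : Set (Measure (X × X)) :=
  {π | IsProbabilityMeasure π ∧ π.map Prod.fst = μ ∧ π.map Prod.snd = ν}

/-- The Wasserstein distance `W_{p,q}` on `ℝ^d`, of order `p` with respect to the `q`-norm: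
`W_{p,q}(μ, ν)^p` is the infimum over all couplings `π` of `∫ ‖x - y‖_q^p dπ(x, y)`. -/
def wassersteinDist {d : ℕ} (p q : ℝ) (μ ν : Measure (Fin d → ℝ)) : ℝ≥0∞ :=
  (⨅ π ∈ couplings μ ν, ∫⁻ z, ENNReal.ofReal (qNorm q (z.1 - z.2) ^ p) ∂π) ^ (1 / p)

/-! ### Integration with respect to a bivariate distribution function -/

/-- `γ` is a probability measure on the plane with joint distribution function `H`. -/
def HasJointCDF (γ : Measure (ℝ × ℝ)) (H : ℝ → ℝ → ℝ) : Prop :=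
  IsProbabilityMeasure γ ∧ ∀ x y, γ.real (Iic x ×ˢ Iic y) = H x y

/-- A bivariate distribution function determines its measure. -/
theorem HasJointCDF.unique {γ γ' : Measure (ℝ × ℝ)} {H : ℝ → ℝ → ℝ}
    (h : HasJointCDF γ H) (h' : HasJointCDF γ' H) : γ = γ' := by
  obtain ⟨_, h⟩ := h
  obtain ⟨_, h'⟩ := h'
  have hspan : IsCountablySpanning (range (Iic : ℝ → Set ℝ)) := by
    refine ⟨fun n => Iic (n : ℝ), fun n => ⟨_, rfl⟩, ?_⟩
    refine eq_univ_of_forall fun x => ?_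
    obtain ⟨n, hn⟩ := exists_nat_ge x
    exact mem_iUnion.2 ⟨n, hn⟩
  have hgen : MeasurableSpace.generateFrom (range (Iic : ℝ → Set ℝ)) = borel ℝ :=
    (borel_eq_generateFrom_Iic ℝ).symm
  refine ext_of_generate_finite
    (image2 (· ×ˢ ·) (range (Iic : ℝ → Set ℝ)) (range (Iic : ℝ → Set ℝ)))
    ?_ (IsPiSystem.prod isPiSystem_Iic isPiSystem_Iic) ?_ (by simp)
  · rw [← generateFrom_prod_eq hspan hspan, hgen, ← BorelSpace.measurable_eq (α := ℝ)]
  · rintro _ ⟨_, ⟨x, rfl⟩, _, ⟨y, rfl⟩, rfl⟩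
    exact (measureReal_eq_measureReal_iff).1 ((h x y).trans (h' x y).symm)

open Classical in
/-- The measure `dH` on the plane with joint distribution function `H` (zero if `H` is not the
joint distribution function of a probability measure). -/
def stieltjesMeasure (H : ℝ → ℝ → ℝ) : Measure (ℝ × ℝ) :=
  if h : ∃ γ, HasJointCDF γ H then h.choose else 0

theorem stieltjesMeasure_eq {γ : Measure (ℝ × ℝ)} {H : ℝ → ℝ → ℝ} (h : HasJointCDF γ H) :
    stieltjesMeasure H = γ := by
  have hex : ∃ γ, HasJointCDF γ H := ⟨γ, h⟩
  rw [stieltjesMeasure, dif_pos hex]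
  exact hex.choose_spec.unique h

/-- For probability measures `m`, `n` on the line with distribution functions `F`, `G`, the function
`M(F(x), G(y))` is the joint distribution function of a probability measure, so that
`stieltjesMeasure` does give its Lebesgue-Stieltjes measure. -/
theorem exists_hasJointCDF_comonotonicity (F G : ℝ → I) (m n : Measure ℝ)
    (hF : ∀ x, (F x : ℝ) = cdf m x) (hG : ∀ x, (G x : ℝ) = cdf n x) :
    ∃ γ, HasJointCDF γ (fun x y => comonotonicityCopula ![F x, G y]) := by
  have key : ∀ (k : Measure ℝ) (u : ℝ), u ∈ Ioo (0 : ℝ) 1 →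
      {x | u ≤ cdf k x}.Nonempty ∧ BddBelow {x | u ≤ cdf k x} := by
    intro k u hu
    constructor
    · obtain ⟨x, hx⟩ := ((tendsto_cdf_atTop k).eventually (lt_mem_nhds hu.2)).exists
      exact ⟨x, hx.le⟩
    · obtain ⟨x, hx⟩ := ((tendsto_cdf_atBot k).eventually (gt_mem_nhds hu.1)).exists
      refine ⟨x, fun y hy => ?_⟩
      by_contra! h
      exact absurd (monotone_cdf k h.le) (not_le.2 (hx.trans_le hy))
  have galois : ∀ (k : Measure ℝ) (u x : ℝ), u ∈ Ioo (0 : ℝ) 1 →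
      (sInf {x | u ≤ cdf k x} ≤ x ↔ u ≤ cdf k x) := by
    intro k u x hu
    obtain ⟨hne, hbdd⟩ := key k u hu
    refine ⟨fun h => ?_, fun h => csInf_le hbdd h⟩
    rw [← (cdf k).iInf_Ioi_eq x]
    have : Nonempty (Ioi x) := ⟨⟨x + 1, by simp⟩⟩
    refine le_ciInf fun y => ?_
    obtain ⟨z, hz, hzy⟩ := exists_lt_of_csInf_lt hne (h.trans_lt y.2)
    exact le_trans hz (monotone_cdf k hzy.le)
  have meas : ∀ k : Measure ℝ, AEMeasurable (fun u => sInf {x | u ≤ cdf k x})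
      (volume.restrict (Ioo (0 : ℝ) 1)) := by
    intro k
    refine aemeasurable_restrict_of_monotoneOn measurableSet_Ioo fun u hu v hv huv => ?_
    exact csInf_le_csInf (key k u hu).2 (key k v hv).1 fun x hx => le_trans huv hx
  have hP : IsProbabilityMeasure (volume.restrict (Ioo (0 : ℝ) 1)) := ⟨by simp⟩
  refine ⟨(volume.restrict (Ioo (0 : ℝ) 1)).map
    (fun u => (sInf {x | u ≤ cdf m x}, sInf {x | u ≤ cdf n x})),
    Measure.isProbabilityMeasure_map ((meas m).prodMk (meas n)), fun x y => ?_⟩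
  have hM : ((comonotonicityCopula ![F x, G y] : I) : ℝ) = min (cdf m x) (cdf n y) := by
    rw [← hF, ← hG]
    simp [comonotonicityCopula, Fin.univ_succ]
  refine Eq.trans ?_ hM.symm
  rw [measureReal_def, Measure.map_apply_of_aemeasurable ((meas m).prodMk (meas n))
    (measurableSet_Iic.prod measurableSet_Iic)]
  have hle : min (cdf m x) (cdf n y) ≤ 1 := (min_le_left _ _).trans (cdf_le_one m x)
  have h0 : 0 ≤ min (cdf m x) (cdf n y) := le_min (cdf_nonneg m x) (cdf_nonneg n y)
  rw [Measure.restrict_apply' measurableSet_Ioo]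
  have hset : (fun u => (sInf {x | u ≤ cdf m x}, sInf {x | u ≤ cdf n x})) ⁻¹' (Iic x ×ˢ Iic y)
      ∩ Ioo (0 : ℝ) 1 = Iic (min (cdf m x) (cdf n y)) ∩ Ioo (0 : ℝ) 1 := by
    ext u
    simp only [mem_inter_iff, mem_preimage, mem_prod, mem_Iic, le_min_iff]
    exact and_congr_left fun hu => and_congr (galois m u x hu) (galois n u y hu)
  rw [hset]
  have hae : (Iic (min (cdf m x) (cdf n y)) ∩ Ioo (0 : ℝ) 1 : Set ℝ) =ᵐ[volume]
      (Ioc 0 (min (cdf m x) (cdf n y)) : Set ℝ) := by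
    have h1 : (Iic (min (cdf m x) (cdf n y)) ∩ Ioc (0 : ℝ) 1 : Set ℝ) =
        Ioc 0 (min (cdf m x) (cdf n y)) := by
      ext u
      simp only [mem_inter_iff, mem_Iic, mem_Ioc]
      exact ⟨fun h => ⟨h.2.1, h.1⟩, fun h => ⟨h.2, h.1, h.2.trans hle⟩⟩
    rw [← h1]
    exact Filter.EventuallyEq.rfl.inter Ioo_ae_eq_Ioc
  rw [measure_congr hae, Real.volume_Ioc, sub_zero, ENNReal.toReal_ofReal h0]

/-- `∑ i, ∫∫ |x_i - y_i|^p dM(F_i(x_i), G_i(y_i))`, where `F_i`, `G_i` are the distribution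
functions of the one-dimensional margins of `μ` and `ν`. -/
def comonotoneCost {d : ℕ} (p : ℝ) (μ ν : Measure (Fin d → ℝ)) : ℝ≥0∞ :=
  ∑ i, ∫⁻ z : ℝ × ℝ, ENNReal.ofReal (|z.1 - z.2| ^ p)
    ∂stieltjesMeasure (fun x y => comonotonicityCopula ![marginCDF μ i x, marginCDF ν i y])

end

/-! ### Optimality of the comonotone coupling on the line -/

/-! For the separable cost `∑ i, |x i - y i| ^ p`, the p-th power of the p-norm, `S` is the exact
minimum over all couplings; the rest is comparison of norms.

Lower bound: on the line, `|x - y| ^ p` is a mixture of the functions `(y - x - r)₊` and `(x - y -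
r)₊`. With fixed margins their integrals decrease as the joint distribution function grows, and that
function never exceeds the minimum of the two marginal ones (`lintegral_abs_sub_rpow_le`,
`measureReal_Iic_prod_Iic_le`).

Attainment: the shared copula is the distribution function of a law on the cube with uniform margins
(`IsCopula.exists_measure`). Applying the quantile functions of both families of margins to the same
random point gives a coupling of `μ` and `ν` that is comonotone in every coordinate, so all `d`
lower bounds are attained at once (`ShareCopula.exists_coupling`).

The pointwise bounds between q-norm and p-norm then transfer to the infimum: the lower bounds hold
for each coupling, the upper ones by testing this coupling. -/

theorem lintegral_rpow_mul_ofReal_sub {p : ℝ} (hp : 1 < p) (a : ℝ) :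
    ∫⁻ r in Ioi (0 : ℝ), ENNReal.ofReal (p * (p - 1) * r ^ (p - 2)) * ENNReal.ofReal (a - r)
      = ENNReal.ofReal (max a 0 ^ p) := by
  rcases le_or_gt a 0 with ha | ha
  · rw [max_eq_right ha, Real.zero_rpow (by linarith), ENNReal.ofReal_zero]
    refine (setLIntegral_congr_fun measurableSet_Ioi fun r (hr : 0 < r) => ?_).trans
      lintegral_zero
    simp [ENNReal.ofReal_of_nonpos (show a - r ≤ 0 by linarith)]
  · rw [max_eq_left ha.le, ← Ioc_union_Ioi_eq_Ioi ha.le,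
      lintegral_union measurableSet_Ioi (Ioc_disjoint_Ioi le_rfl)]
    have h2 : ∫⁻ r in Ioi a, ENNReal.ofReal (p * (p - 1) * r ^ (p - 2)) * ENNReal.ofReal (a - r)
        = 0 := by
      refine (setLIntegral_congr_fun measurableSet_Ioi fun r (hr : a < r) => ?_).trans
        lintegral_zero
      simp [ENNReal.ofReal_of_nonpos (show a - r ≤ 0 by linarith)]
    -- The exponent `p - 2` may be negative, but it exceeds `-1`, so the singularity at `0` is
    -- integrable.
    have hint : ∀ s : ℝ, -1 < s → IntervalIntegrable (fun r : ℝ => r ^ s) volume 0 a :=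
      fun s hs => intervalIntegral.intervalIntegrable_rpow' hs
    have i1 := (hint (p - 2) (by linarith)).const_mul (p * (p - 1) * a)
    have i2 := (hint (p - 1) (by linarith)).const_mul (p * (p - 1))
    have hpt : ∀ r ∈ Ioc 0 a, p * (p - 1) * r ^ (p - 2) * (a - r) =
        p * (p - 1) * a * r ^ (p - 2) - p * (p - 1) * r ^ (p - 1) := by
      intro r hr
      rw [show p - 1 = p - 2 + 1 by ring, Real.rpow_add_one hr.1.ne']
      ring
    have h1 : ∫⁻ r in Ioc 0 a, ENNReal.ofReal (p * (p - 1) * r ^ (p - 2)) * ENNReal.ofReal (a - r)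
        = ∫⁻ r in Ioc 0 a, ENNReal.ofReal
          (p * (p - 1) * a * r ^ (p - 2) - p * (p - 1) * r ^ (p - 1)) := by
      refine setLIntegral_congr_fun measurableSet_Ioc fun r hr => ?_
      have : 0 ≤ p * (p - 1) * r ^ (p - 2) :=
        mul_nonneg (mul_nonneg (by linarith) (by linarith)) (Real.rpow_nonneg hr.1.le _)
      rw [← ENNReal.ofReal_mul this, hpt r hr]
    rw [h2, add_zero, h1, ← ofReal_integral_eq_lintegral_ofReal,
      ← intervalIntegral.integral_of_le ha.le, intervalIntegral.integral_sub i1 i2,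
      intervalIntegral.integral_const_mul, intervalIntegral.integral_const_mul,
      integral_rpow (Or.inl (by linarith)), integral_rpow (Or.inl (by linarith))]
    · congr 1
      rw [show p - 2 + 1 = p - 1 by ring, sub_add_cancel, Real.zero_rpow (by linarith),
        Real.zero_rpow (by linarith)]
      have : a ^ p = a ^ (p - 1) * a := by
        rw [← Real.rpow_add_one ha.ne', sub_add_cancel]
      rw [this]
      have : p - 1 ≠ 0 := by linarith
      field_simp
      ring
    · exact (i1.sub i2).1
    · refine (ae_restrict_iff' measurableSet_Ioc).2 (Filter.Eventually.of_forall fun r hr => ?_)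
      refine le_of_le_of_eq ?_ (hpt r hr)
      exact mul_nonneg (mul_nonneg (mul_nonneg (by linarith) (by linarith))
        (Real.rpow_nonneg hr.1.le _)) (by linarith [hr.2])

/-- `(a₊)^p` is a mixture of the functions `(a - r)₊`. -/
theorem exists_measure_lintegral_ofReal_sub {p : ℝ} (hp : 1 ≤ p) :
    ∃ ρ : Measure ℝ, SFinite ρ ∧
      ∀ a, ENNReal.ofReal (max a 0 ^ p) = ∫⁻ r, ENNReal.ofReal (a - r) ∂ρ := by
  rcases hp.eq_or_lt with rfl | hp
  -- The mixing measure is the second derivative of `(a₊) ^ p`; at `p = 1` it degenerates to a point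
  -- mass at `0`.
  · refine ⟨Measure.dirac 0, inferInstance, fun a => ?_⟩
    rw [lintegral_dirac]
    rw [Real.rpow_one, sub_zero, ENNReal.ofReal_max, ENNReal.ofReal_zero, max_eq_left zero_le]
  · refine ⟨(volume.restrict (Ioi 0)).withDensity
      fun r => ENNReal.ofReal (p * (p - 1) * r ^ (p - 2)), inferInstance, fun a => ?_⟩
    rw [lintegral_withDensity_eq_lintegral_mul _ (by fun_prop) (by fun_prop)]
    exact (lintegral_rpow_mul_ofReal_sub hp a).symm

/-- `(y - x - r)₊` is the length of the interval `x ≤ s < y - r`; Tonelli does the rest. -/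
theorem lintegral_ofReal_snd_sub_fst_sub (γ : Measure (ℝ × ℝ)) [SFinite γ] (r : ℝ) :
    ∫⁻ z, ENNReal.ofReal (z.2 - z.1 - r) ∂γ = ∫⁻ s, γ (Iic s ×ˢ Ioi (s + r)) := by
  have hS : MeasurableSet {w : (ℝ × ℝ) × ℝ | w.1.1 ≤ w.2 ∧ w.2 + r < w.1.2} := by
    have h1 : MeasurableSet {w : (ℝ × ℝ) × ℝ | w.1.1 ≤ w.2} :=
      measurableSet_le (by fun_prop) (by fun_prop)
    have h2 : MeasurableSet {w : (ℝ × ℝ) × ℝ | w.2 + r < w.1.2} :=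
      measurableSet_lt (by fun_prop) (by fun_prop)
    exact h1.inter h2
  have h1 := Measure.prod_apply (μ := γ) (ν := (volume : Measure ℝ)) hS
  rw [Measure.prod_apply_symm hS] at h1
  refine Eq.trans (lintegral_congr fun z => ?_) h1.symm
  have : Prod.mk z ⁻¹' {w : (ℝ × ℝ) × ℝ | w.1.1 ≤ w.2 ∧ w.2 + r < w.1.2} = Ico z.1 (z.2 - r) := by
    ext s
    simp [lt_sub_iff_add_lt]
  rw [this, Real.volume_Ico]
  congr 1
  ring

/-- The first margin fixes the mass of the whole strip, so more mass below `y` leaves less above. -/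
theorem measure_Iic_prod_Ioi_le {γ π : Measure (ℝ × ℝ)} [IsFiniteMeasure γ] [IsFiniteMeasure π]
    (hfst : γ.map Prod.fst = π.map Prod.fst)
    (hle : ∀ x y, π (Iic x ×ˢ Iic y) ≤ γ (Iic x ×ˢ Iic y)) (x y : ℝ) :
    γ (Iic x ×ˢ Ioi y) ≤ π (Iic x ×ˢ Ioi y) := by
  have key : ∀ κ : Measure (ℝ × ℝ), κ (Iic x ×ˢ Iic y) + κ (Iic x ×ˢ Ioi y) =
      κ.map Prod.fst (Iic x) := by
    intro κ
    rw [← measure_union (Disjoint.set_prod_right (Iic_disjoint_Ioi le_rfl) _ _)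
      (measurableSet_Iic.prod measurableSet_Ioi), ← prod_union, Iic_union_Ioi,
      Measure.map_apply measurable_fst measurableSet_Iic, prod_univ]
  have h := (key γ).trans ((congrArg (· (Iic x)) hfst).trans (key π).symm)
  refine (ENNReal.add_le_add_iff_left (measure_ne_top γ (Iic x ×ˢ Iic y))).1 ?_
  rw [h]
  exact add_le_add_left (hle x y) _

theorem lintegral_posPart_rpow_le {p : ℝ} (hp : 1 ≤ p) {γ π : Measure (ℝ × ℝ)}
    [IsFiniteMeasure γ] [IsFiniteMeasure π] (hfst : γ.map Prod.fst = π.map Prod.fst)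
    (hle : ∀ x y, π (Iic x ×ˢ Iic y) ≤ γ (Iic x ×ˢ Iic y)) :
    ∫⁻ z, ENNReal.ofReal (max (z.2 - z.1) 0 ^ p) ∂γ ≤
      ∫⁻ z, ENNReal.ofReal (max (z.2 - z.1) 0 ^ p) ∂π := by
  obtain ⟨ρ, _, hρ⟩ := exists_measure_lintegral_ofReal_sub hp
  have key : ∀ κ : Measure (ℝ × ℝ), IsFiniteMeasure κ →
      ∫⁻ z, ENNReal.ofReal (max (z.2 - z.1) 0 ^ p) ∂κ =
        ∫⁻ r, (∫⁻ s, κ (Iic s ×ˢ Ioi (s + r))) ∂ρ := by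
    intro κ _
    simp_rw [hρ]
    rw [lintegral_lintegral_swap (by fun_prop)]
    simp_rw [lintegral_ofReal_snd_sub_fst_sub]
  rw [key γ inferInstance, key π inferInstance]
  exact lintegral_mono fun r => lintegral_mono fun s => measure_Iic_prod_Ioi_le hfst hle _ _

/-- Among the measures on the plane with given margins, one with the pointwise largest joint
distribution function has the smallest cost `∫ |x - y|^p`. -/
theorem lintegral_abs_sub_rpow_le {p : ℝ} (hp : 1 ≤ p) {γ π : Measure (ℝ × ℝ)}
    [IsFiniteMeasure γ] [IsFiniteMeasure π] (hfst : γ.map Prod.fst = π.map Prod.fst)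
    (hsnd : γ.map Prod.snd = π.map Prod.snd)
    (hle : ∀ x y, π (Iic x ×ˢ Iic y) ≤ γ (Iic x ×ˢ Iic y)) :
    ∫⁻ z, ENNReal.ofReal (|z.1 - z.2| ^ p) ∂γ ≤ ∫⁻ z, ENNReal.ofReal (|z.1 - z.2| ^ p) ∂π := by
  have hsplit : ∀ x y : ℝ, ENNReal.ofReal (|x - y| ^ p) =
      ENNReal.ofReal (max (y - x) 0 ^ p) + ENNReal.ofReal (max (x - y) 0 ^ p) := by
    intro x y
    have hp0 : p ≠ 0 := by linarith
    rcases le_total x y with h | h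
    · rw [max_eq_left (sub_nonneg.2 h), max_eq_right (sub_nonpos.2 h), abs_sub_comm,
        abs_of_nonneg (sub_nonneg.2 h), Real.zero_rpow hp0, ENNReal.ofReal_zero, add_zero]
    · rw [max_eq_left (sub_nonneg.2 h), max_eq_right (sub_nonpos.2 h),
        abs_of_nonneg (sub_nonneg.2 h), Real.zero_rpow hp0, ENNReal.ofReal_zero, zero_add]
  -- Exchanging the coordinates turns the second half of the cost into the first.
  have hswap : ∀ κ : Measure (ℝ × ℝ), ∫⁻ z, ENNReal.ofReal (max (z.1 - z.2) 0 ^ p) ∂κ =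
      ∫⁻ z, ENNReal.ofReal (max (z.2 - z.1) 0 ^ p) ∂(κ.map Prod.swap) := fun κ => by
    rw [lintegral_map (by fun_prop) measurable_swap]
    rfl
  simp_rw [hsplit]
  rw [lintegral_add_left (by fun_prop), lintegral_add_left (by fun_prop), hswap γ, hswap π]
  refine add_le_add (lintegral_posPart_rpow_le hp hfst hle)
    (lintegral_posPart_rpow_le hp ?_ fun x y => ?_)
  · rw [Measure.map_map measurable_fst measurable_swap,
      Measure.map_map measurable_fst measurable_swap]
    exact hsnd
  · rw [Measure.map_apply measurable_swap (measurableSet_Iic.prod measurableSet_Iic),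
      Measure.map_apply measurable_swap (measurableSet_Iic.prod measurableSet_Iic),
      preimage_swap_prod]
    exact hle y x

/-! ### The probability measure of a copula -/

/-- Summation of the mixed differences of `f` over a box. -/
theorem sum_piFinset_range_alternating {d : ℕ} (f : (Fin d → ℕ) → ℝ)
    (hf : ∀ m, (∃ i, m i = 0) → f m = 0) (j : Fin d → ℕ) :
    ∑ k ∈ Fintype.piFinset fun i => Finset.range (j i), ∑ s : Finset (Fin d),
      (-1 : ℝ) ^ s.card * f (fun i => if i ∈ s then k i else k i + 1) = f j := by
  let δ : ℕ → ℕ → ℝ := fun a b => if a = b then 1 else 0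
  let B := Fintype.piFinset fun i => Finset.range (j i + 1)
  -- Expanding `f` in products of point indicators reduces the claim to products, where the
  -- alternating sum factorizes and each factor telescopes.
  have hδ : ∀ x ∈ B, f x = ∑ m ∈ B, f m * ∏ i, δ (x i) (m i) := by
    intro x hx
    rw [Finset.sum_eq_single x]
    · simp [δ]
    · intro m _ hm
      obtain ⟨i, hi⟩ := Function.ne_iff.1 hm
      rw [Finset.prod_eq_zero (Finset.mem_univ i) (by simp [δ, Ne.symm hi]), mul_zero]
    · exact fun h => absurd hx h
  have hexp : ∀ k m : Fin d → ℕ,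
      ∑ s : Finset (Fin d), (-1 : ℝ) ^ s.card * ∏ i, δ (if i ∈ s then k i else k i + 1) (m i) =
        ∏ i, (δ (k i + 1) (m i) - δ (k i) (m i)) := by
    intro k m
    simp_rw [sub_eq_neg_add, Fintype.prod_add]
    refine Finset.sum_congr rfl fun s _ => ?_
    rw [Finset.prod_neg, mul_assoc, ← Finset.prod_mul_prod_compl s]
    congr 2
    · exact Finset.prod_congr rfl fun i hi => by rw [if_pos hi]
    · exact Finset.prod_congr rfl fun i hi => by rw [if_neg (Finset.mem_compl.1 hi)]
  calc
    _ = ∑ k ∈ Fintype.piFinset fun i => Finset.range (j i), ∑ s : Finset (Fin d),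
          (-1 : ℝ) ^ s.card *
            ∑ m ∈ B, f m * ∏ i, δ (if i ∈ s then k i else k i + 1) (m i) := by
        refine Finset.sum_congr rfl fun k hk => Finset.sum_congr rfl fun s _ => ?_
        rw [← hδ]
        refine Fintype.mem_piFinset.2 fun i => ?_
        have := Finset.mem_range.1 (Fintype.mem_piFinset.1 hk i)
        rw [Finset.mem_range]
        split_ifs <;> omega
    _ = ∑ m ∈ B, f m * ∑ k ∈ Fintype.piFinset fun i => Finset.range (j i),
          ∏ i, (δ (k i + 1) (m i) - δ (k i) (m i)) := by
        simp_rw [← hexp, Finset.mul_sum]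
        rw [Finset.sum_comm (s := B)]
        refine Finset.sum_congr rfl fun k _ => ?_
        rw [Finset.sum_comm]
        exact Finset.sum_congr rfl fun m _ => Finset.sum_congr rfl fun s _ => mul_left_comm _ _ _
    _ = ∑ m ∈ B, f m * ∏ i, (δ (j i) (m i) - δ 0 (m i)) := by
        refine Finset.sum_congr rfl fun m _ => ?_
        rw [← Finset.prod_univ_sum (fun i => Finset.range (j i))
          (fun i k => δ (k + 1) (m i) - δ k (m i))]
        congr 1
        exact Finset.prod_congr rfl fun i _ => Finset.sum_range_sub (fun k => δ k (m i)) (j i)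
    _ = f j := by
        have hj : j ∈ B := Fintype.mem_piFinset.2 fun i => by simp
        refine Eq.trans (Finset.sum_congr rfl fun m _ => ?_) (hδ j hj).symm
        -- The lower boundary terms `δ 0 (m i)` matter only where `f m` vanishes.
        by_cases hm : ∃ i, m i = 0
        · rw [hf m hm, zero_mul, zero_mul]
        · push Not at hm
          simp [δ, (hm _).symm]

theorem exists_strictMonoOn_grid (A : Finset I) :
    ∃ (N : ℕ) (e : ℕ → I), StrictMonoOn e (Iic N) ∧ e 0 = 0 ∧ e N = 1 ∧
      ∀ a ∈ A, ∃ j ≤ N, e j = a := by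
  set B : Finset I := insert 0 (insert 1 A) with hB
  have h0 : (0 : I) ∈ B := by simp [hB]
  have h1 : (1 : I) ∈ B := by simp [hB]
  have hpos : 0 < B.card := Finset.card_pos.2 ⟨0, h0⟩
  have hsurj : ∀ a ∈ B, ∃ k : Fin B.card, B.orderEmbOfFin rfl k = a := fun a ha => by
    have : a ∈ Set.range (B.orderEmbOfFin rfl) := by rwa [Finset.range_orderEmbOfFin]
    exact this
  -- The increasing enumeration of `A ∪ {0, 1}`, held constant after its last index.
  let e : ℕ → I := fun k => B.orderEmbOfFin rfl ⟨min k (B.card - 1), by omega⟩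
  have he : ∀ k : Fin B.card, e k = B.orderEmbOfFin rfl k := fun k => by
    have : min (k : ℕ) (B.card - 1) = k := by omega
    simp [e, this]
  refine ⟨B.card - 1, e, ?_, ?_, ?_, ?_⟩
  · intro a ha b hb hab
    simp only [mem_Iic] at ha hb
    refine (B.orderEmbOfFin rfl).strictMono ?_
    simp only [Fin.mk_lt_mk]
    omega
  · obtain ⟨k, hk⟩ := hsurj 0 h0
    refine le_antisymm ?_ unitInterval.nonneg'
    rw [← hk]
    exact (B.orderEmbOfFin rfl).monotone (by simp [Fin.le_def])
  · obtain ⟨k, hk⟩ := hsurj 1 h1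
    refine le_antisymm unitInterval.le_one' ?_
    rw [← hk]
    refine (B.orderEmbOfFin rfl).monotone ?_
    simp only [Fin.le_def]
    omega
  · intro a ha
    obtain ⟨k, hk⟩ := hsurj a (by simp [hB, ha])
    exact ⟨k, by omega, (he k).trans hk⟩

/-- The `C`-volume of each grid cell is placed as an atom at its upper corner. The orthant below a
grid point then captures exactly the cells below that point, and their volumes sum to `C`. -/
theorem IsCopula.exists_probabilityMeasure_grid {d : ℕ} {C : (Fin d → I) → I} (hC : IsCopula C)
    (h1 : C (fun _ => 1) = 1) (A : Finset I) :
    ∃ P : ProbabilityMeasure (Fin d → I), ∀ g : Fin d → I, (∀ i, g i ∈ A) →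
      (P : Measure (Fin d → I)) (Iic g) = ENNReal.ofReal (C g) := by
  obtain ⟨N, e, he, he0, heN, hA⟩ := exists_strictMonoOn_grid A
  let V : (Fin d → ℕ) → ℝ := fun k => ∑ s : Finset (Fin d), (-1 : ℝ) ^ s.card *
    (C (fun i => e (if i ∈ s then k i else k i + 1)) : ℝ)
  have hV : ∀ k ∈ Fintype.piFinset fun _ : Fin d => Finset.range N, 0 ≤ V k := by
    intro k hk
    have := hC.increasing (fun i => e (k i)) (fun i => e (k i + 1)) fun i => by
      have := Finset.mem_range.1 (Fintype.mem_piFinset.1 hk i)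
      exact he.monotoneOn (mem_Iic.2 (by omega)) (mem_Iic.2 (by omega)) (by omega)
    simpa only [V, apply_ite e] using this
  let P : Measure (Fin d → I) := ∑ k ∈ Fintype.piFinset fun _ : Fin d => Finset.range N,
    ENNReal.ofReal (V k) • Measure.dirac (fun i => e (k i + 1))
  have hP : ∀ j : Fin d → ℕ, (∀ i, j i ≤ N) →
      P (Iic fun i => e (j i)) = ENNReal.ofReal (C fun i => e (j i)) := by
    intro j hj
    have hsub : (Fintype.piFinset fun i => Finset.range (j i)) ⊆
        Fintype.piFinset fun _ : Fin d => Finset.range N :=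
      Fintype.piFinset_subset _ _ fun i => Finset.range_mono (hj i)
    rw [← sum_piFinset_range_alternating (fun m => (C (fun i => e (m i)) : ℝ)) _ j,
      ENNReal.ofReal_sum_of_nonneg fun k hk => hV k (hsub hk), Measure.finsetSum_apply,
      ← Finset.sum_subset hsub]
    · refine Finset.sum_congr rfl fun k hk => ?_
      have hmem : (fun i => e (k i + 1)) ∈ Iic fun i => e (j i) := fun i => by
        have := Finset.mem_range.1 (Fintype.mem_piFinset.1 hk i)
        have := hj i
        exact he.monotoneOn (mem_Iic.2 (by omega)) (mem_Iic.2 (by omega)) (by omega)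
      rw [Measure.smul_apply, Measure.dirac_apply' _ measurableSet_Iic, indicator_of_mem hmem]
      simp [V]
    · intro k hk hkj
      have hmem : (fun i => e (k i + 1)) ∉ Iic fun i => e (j i) := fun h => by
        refine hkj (Fintype.mem_piFinset.2 fun i => ?_)
        have := Finset.mem_range.1 (Fintype.mem_piFinset.1 hk i)
        have := (he.le_iff_le (mem_Iic.2 (by omega)) (mem_Iic.2 (hj i))).1 (h i)
        exact Finset.mem_range.2 (by omega)
      rw [Measure.smul_apply, Measure.dirac_apply' _ measurableSet_Iic, indicator_of_notMem hmem,
        smul_zero]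
    · rintro m ⟨i, hi⟩
      rw [hC.grounded _ ⟨i, by rw [hi, he0]⟩]
      rfl
  have hprob : IsProbabilityMeasure P := by
    refine ⟨?_⟩
    have := hP (fun _ => N) fun _ => le_rfl
    simp only [heN, h1] at this
    rw [← show (Iic fun _ : Fin d => (1 : I)) = univ from
      eq_univ_of_forall fun z i => unitInterval.le_one', this]
    simp
  refine ⟨⟨P, hprob⟩, fun g hg => ?_⟩
  choose j hj hjg using fun i => hA (g i) (hg i)
  obtain rfl : (fun i => e (j i)) = g := funext hjg
  exact hP j hj

theorem volume_unitInterval_Iic (t : I) : volume (Iic t) = ENNReal.ofReal t := by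
  simp

/-- Probability measures on the compact cube form a compact space, so the grid measures have a
limit. Its margins are identified first: being atomless, they make the boundaries of orthants null,
and the values `C g` pass to the limit. -/
theorem IsCopula.exists_measure {d : ℕ} {C : (Fin d → I) → I} (hC : IsCopula C)
    (h1 : C (fun _ => 1) = 1) :
    ∃ P : Measure (Fin d → I), IsProbabilityMeasure P ∧
      (∀ g, P (Iic g) = ENNReal.ofReal (C g)) ∧ ∀ i, P.map (fun z => z i) = volume := by
  choose Q hQ using hC.exists_probabilityMeasure_grid h1
  -- Along an ultrafilter finer than `atTop`, every `g` is eventually a grid point.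
  let U : Ultrafilter (Finset I) := Ultrafilter.of Filter.atTop
  obtain ⟨P, -, hP⟩ := isCompact_univ.ultrafilter_le_nhds (U.map Q) (by simp)
  have hP : Filter.Tendsto Q U (nhds P) := hP
  have hlim : ∀ g : Fin d → I, Filter.Tendsto (fun A => (Q A : Measure (Fin d → I)) (Iic g)) U
      (nhds (ENNReal.ofReal (C g))) := by
    intro g
    refine tendsto_const_nhds.congr' ?_
    have : ∀ᶠ A : Finset I in Filter.atTop, Finset.univ.image g ≤ A := Filter.eventually_ge_atTop _
    filter_upwards [(Ultrafilter.of_le _ : (U : Filter (Finset I)) ≤ Filter.atTop) this] with A hA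
    exact (hQ A g fun i => hA (Finset.mem_image_of_mem g (Finset.mem_univ i))).symm
  have hmargin : ∀ i, (P : Measure (Fin d → I)).map (fun z => z i) = volume := by
    intro i
    have hIic : ∀ t : I, {z : Fin d → I | z i ≤ t} = Iic (Function.update (fun _ => 1) i t) := by
      intro t
      ext z
      rw [mem_Iic, le_update_iff]
      exact ⟨fun h => ⟨h, fun _ _ => unitInterval.le_one'⟩, fun h => h.1⟩
    have hlow : ∀ t : I, ENNReal.ofReal t ≤ (P : Measure (Fin d → I)) {z | z i ≤ t} := by
      intro t
      have := ProbabilityMeasure.limsup_measure_closed_le_of_tendsto hP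
        (F := Iic (Function.update (fun _ => 1) i t)) isClosed_Iic
      rwa [(hlim _).limsup_eq, hC.uniform_margins, ← hIic] at this
    have hupp : ∀ t : I, (P : Measure (Fin d → I)) {z | z i < t} ≤ ENNReal.ofReal t := by
      intro t
      refine (ProbabilityMeasure.le_liminf_measure_open_of_tendsto hP
        (isOpen_lt (continuous_apply i) continuous_const)).trans ?_
      have := hlim (Function.update (fun _ => 1) i t)
      rw [hC.uniform_margins, ← hIic] at this
      rw [← this.liminf_eq]
      exact Filter.liminf_le_liminf (.of_forall fun A => measure_mono fun z (hz : z i < t) => hz.le)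
    have := Measure.isProbabilityMeasure_map (μ := (P : Measure (Fin d → I)))
      (measurable_pi_apply i).aemeasurable
    refine Measure.ext_of_Iic _ _ fun t => ?_
    rw [Measure.map_apply (measurable_pi_apply i) measurableSet_Iic, volume_unitInterval_Iic]
    refine le_antisymm ?_ (hlow t)
    -- The upper bound is known only for strict inequalities, so `t` is enlarged by `ε`.
    refine ENNReal.le_of_forall_pos_le_add fun ε hε _ => ?_
    rcases le_or_gt 1 ((t : ℝ) + ε) with h | h
    · refine prob_le_one.trans ?_
      rw [← ENNReal.ofReal_coe_nnreal (p := ε), ← ENNReal.ofReal_add t.2.1 ε.coe_nonneg,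
        ← ENNReal.ofReal_one]
      exact ENNReal.ofReal_le_ofReal h
    · have hε' : (0 : ℝ) < ε := hε
      let t' : I := ⟨t + ε, by linarith [t.2.1], h.le⟩
      have htt' : t < t' := show (t : ℝ) < t + ε by linarith
      have hsub : {z : Fin d → I | z i ≤ t} ⊆ {z | z i < t'} :=
        fun z (hz : z i ≤ t) => hz.trans_lt htt'
      refine (measure_mono hsub).trans ((hupp t').trans_eq ?_)
      · rw [show (t' : ℝ) = t + ε from rfl, ENNReal.ofReal_add t.2.1 ε.coe_nonneg,
          ENNReal.ofReal_coe_nnreal]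
  refine ⟨P, inferInstance, fun g => ?_, hmargin⟩
  refine tendsto_nhds_unique
    (ProbabilityMeasure.tendsto_measure_of_null_frontier_of_tendsto' hP ?_) (hlim g)
  refine measure_mono_null (t := ⋃ i, {z : Fin d → I | z i = g i}) (fun z hz => ?_)
    (measure_iUnion_null fun i => ?_)
  · by_contra hne
    simp only [mem_iUnion, mem_ofPred_eq, not_exists] at hne
    rw [isClosed_Iic.frontier_eq] at hz
    refine hz.2 (interior_maximal (s := Iic g) (t := {w : Fin d → I | ∀ i, w i < g i}) ?_ ?_ ?_)
    · exact fun w hw i => (hw i).le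
    · rw [ofPred_forall]
      exact isOpen_iInter_of_finite fun i => isOpen_lt (continuous_apply i) continuous_const
    · exact fun i => lt_of_le_of_ne (hz.1 i) (hne i)
  · have := Measure.map_apply (μ := (P : Measure (Fin d → I))) (measurable_pi_apply i)
      (measurableSet_singleton (g i))
    rw [hmargin i, measure_singleton] at this
    exact this.symm

/-! ### Couplings from a common copula -/

/-- The quantile function of `m`, with value `0` at the endpoints of `[0,1]`. -/
noncomputable def quantile (m : Measure ℝ) (u : I) : ℝ :=
  open Classical in if 0 < u ∧ u < 1 then sInf {x | (u : ℝ) ≤ cdf m x} else 0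

theorem quantile_le_iff (m : Measure ℝ) {u : I} (hu : 0 < u ∧ u < 1) (x : ℝ) :
    quantile m u ≤ x ↔ (u : ℝ) ≤ cdf m x := by
  have h0 : (0 : ℝ) < u := hu.1
  have h1 : (u : ℝ) < 1 := hu.2
  have hne : {x | (u : ℝ) ≤ cdf m x}.Nonempty := by
    obtain ⟨x, hx⟩ := ((tendsto_cdf_atTop m).eventually (lt_mem_nhds h1)).exists
    exact ⟨x, hx.le⟩
  have hbdd : BddBelow {x | (u : ℝ) ≤ cdf m x} := by
    obtain ⟨x, hx⟩ := ((tendsto_cdf_atBot m).eventually (gt_mem_nhds h0)).exists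
    refine ⟨x, fun y hy => ?_⟩
    by_contra! h
    exact absurd (monotone_cdf m h.le) (not_le.2 (hx.trans_le hy))
  rw [quantile, if_pos hu]
  refine ⟨fun h => ?_, fun h => csInf_le hbdd h⟩
  -- Right continuity of the distribution function is what includes the infimum itself.
  rw [← (cdf m).iInf_Ioi_eq x]
  have : Nonempty (Ioi x) := ⟨⟨x + 1, by simp⟩⟩
  refine le_ciInf fun y => ?_
  obtain ⟨z, hz, hzy⟩ := exists_lt_of_csInf_lt hne (h.trans_lt y.2)
  exact le_trans hz (monotone_cdf m hzy.le)

@[fun_prop]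
theorem measurable_quantile (m : Measure ℝ) : Measurable (quantile m) := by
  refine measurable_of_Iic fun x => ?_
  have h1 : MeasurableSet {u : I | 0 < u ∧ u < 1} := measurableSet_Ioo
  have h2 : MeasurableSet {u : I | (u : ℝ) ≤ cdf m x} :=
    measurableSet_le measurable_subtype_coe measurable_const
  have : quantile m ⁻¹' Iic x = {u : I | 0 < u ∧ u < 1} ∩ {u : I | (u : ℝ) ≤ cdf m x} ∪
      {u : I | 0 < u ∧ u < 1}ᶜ ∩ {_u : I | 0 ≤ x} := by
    ext u
    by_cases hu : 0 < u ∧ u < 1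
    · simp only [mem_preimage, mem_Iic, quantile_le_iff m hu, mem_union, mem_inter_iff,
        mem_ofPred_eq, mem_compl_iff, hu, and_self, true_and, not_true, false_and, or_false]
    · simp only [mem_preimage, mem_Iic, quantile, hu, if_false, mem_union, mem_inter_iff,
        mem_ofPred_eq, mem_compl_iff, false_and, false_or, not_false_iff, true_and]
  rw [this]
  exact (h1.inter h2).union (h1.compl.inter (MeasurableSet.const _))

/-- The exceptional set `{0, 1}` is the same for all `m` and `x`. -/
theorem ae_quantile_le_iff : ∀ᵐ u : I, ∀ (m : Measure ℝ) (x : ℝ),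
    quantile m u ≤ x ↔ (u : ℝ) ≤ cdf m x := by
  have h0 : ∀ᵐ u : I, u ≠ 0 := by simp [ae_iff]
  have h1 : ∀ᵐ u : I, u ≠ 1 := by simp [ae_iff]
  filter_upwards [h0, h1] with u hu0 hu1 m x
  exact quantile_le_iff m ⟨unitInterval.pos_iff_ne_zero.2 hu0, unitInterval.lt_one_iff_ne_one.2 hu1⟩
    x

theorem ext_of_jointCDF {d : ℕ} {μ ν : Measure (Fin d → ℝ)} [IsProbabilityMeasure μ]
    [IsProbabilityMeasure ν] (h : ∀ x, μ (Iic x) = ν (Iic x)) : μ = ν := by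
  have hspan : IsCountablySpanning (range (Iic : ℝ → Set ℝ)) := by
    refine ⟨fun n => Iic (n : ℝ), fun n => ⟨_, rfl⟩, ?_⟩
    refine eq_univ_of_forall fun x => ?_
    obtain ⟨n, hn⟩ := exists_nat_ge x
    exact mem_iUnion.2 ⟨n, hn⟩
  have hgen : MeasurableSpace.generateFrom (range (Iic : ℝ → Set ℝ)) = borel ℝ :=
    (borel_eq_generateFrom_Iic ℝ).symm
  refine ext_of_generate_finite
    (pi univ '' pi univ fun _ : Fin d => range (Iic : ℝ → Set ℝ))
    (generateFrom_eq_pi (fun _ => ?_) fun _ => hspan).symm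
    (IsPiSystem.pi fun _ => isPiSystem_Iic) ?_ (by simp)
  · rw [hgen, ← BorelSpace.measurable_eq (α := ℝ)]
  · rintro _ ⟨s, hs, rfl⟩
    choose x hx using fun i => hs i (mem_univ i)
    obtain rfl : (fun i => Iic (x i)) = s := funext hx
    rw [pi_univ_Iic]
    exact h x

/-- Inverse transform sampling: almost surely, the image point lies below `x` exactly when `u` lies
below the marginal values at `x`. -/
theorem map_quantile_eq {d : ℕ} {P : Measure (Fin d → I)} [IsProbabilityMeasure P]
    (hP : ∀ i, P.map (fun z => z i) = volume) {μ : Measure (Fin d → ℝ)} [IsProbabilityMeasure μ]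
    (h : ∀ x, P (Iic fun i => marginCDF μ i (x i)) = ENNReal.ofReal (jointCDF μ x)) :
    P.map (fun u i => quantile (μ.map (fun z => z i)) (u i)) = μ := by
  have hmeas : Measurable fun (u : Fin d → I) i => quantile (μ.map (fun z => z i)) (u i) := by
    fun_prop
  have := Measure.isProbabilityMeasure_map (μ := P) hmeas.aemeasurable
  refine ext_of_jointCDF fun x => ?_
  have hae : ∀ i, ∀ᵐ u ∂P, ∀ (m : Measure ℝ) (x : ℝ),
      quantile m (u i) ≤ x ↔ (u i : ℝ) ≤ cdf m x := fun i => by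
    have := ae_quantile_le_iff
    rw [← hP i] at this
    exact ae_of_ae_map (measurable_pi_apply i).aemeasurable this
  rw [Measure.map_apply hmeas measurableSet_Iic]
  have : ENNReal.ofReal (jointCDF μ x) = μ (Iic x) := by
    rw [jointCDF, ofReal_measureReal]
    rfl
  rw [← this, ← h x]
  refine measure_congr ?_
  filter_upwards [ae_all_iff.2 hae] with u hu
  refine propext ?_
  exact forall_congr' fun i => hu i _ _

theorem coe_comonotonicityCopula_pair (a b : I) :
    ((comonotonicityCopula ![a, b] : I) : ℝ) = min (a : ℝ) b := by
  simp [comonotonicityCopula, Fin.univ_succ]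

theorem hasJointCDF_map_quantile {P : Measure I} (hP : P = volume) (m n : Measure ℝ) :
    HasJointCDF (P.map fun u => (quantile m u, quantile n u))
      (fun x y => min (cdf m x) (cdf n y)) := by
  subst hP
  have hmeas : Measurable fun u => (quantile m u, quantile n u) := by fun_prop
  refine ⟨Measure.isProbabilityMeasure_map hmeas.aemeasurable, fun x y => ?_⟩
  rw [measureReal_def, Measure.map_apply hmeas (measurableSet_Iic.prod measurableSet_Iic)]
  have h0 : 0 ≤ min (cdf m x) (cdf n y) := le_min (cdf_nonneg m x) (cdf_nonneg n y)
  let t : I := ⟨min (cdf m x) (cdf n y), h0, (min_le_left _ _).trans (cdf_le_one m x)⟩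
  have : (fun u => (quantile m u, quantile n u)) ⁻¹' (Iic x ×ˢ Iic y) =ᵐ[volume] Iic t := by
    filter_upwards [ae_quantile_le_iff] with u hu
    refine propext ?_
    exact (and_congr (hu m x) (hu n y)).trans le_min_iff.symm
  rw [measure_congr this, volume_unitInterval_Iic]
  exact ENNReal.toReal_ofReal h0

/-- Measures which share a copula have a coupling all of whose bivariate margins are comonotone. -/
theorem ShareCopula.exists_coupling {d : ℕ} {μ ν : Measure (Fin d → ℝ)} [IsProbabilityMeasure μ]
    [IsProbabilityMeasure ν] (h : ShareCopula μ ν) :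
    ∃ π ∈ couplings μ ν, ∀ i, HasJointCDF (π.map fun z => (z.1 i, z.2 i))
      (fun x y => comonotonicityCopula ![marginCDF μ i x, marginCDF ν i y]) := by
  obtain ⟨C, hC, hμ, hν⟩ := h
  -- For `d = 0` the margin condition is vacuous; the value comes from the total mass of `μ`.
  have h1 : C (fun _ => 1) = 1 := by
    rcases Nat.eq_zero_or_pos d with rfl | hd
    · have := hμ 0
      simp only [jointCDF, IsEmpty.forall_iff, ofPred_true, probReal_univ] at this
      refine Subtype.ext (Eq.trans ?_ this.symm)
      congr 2
      exact Subsingleton.elim _ _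
    · have := hC.uniform_margins ⟨0, hd⟩ 1
      rwa [Function.update_eq_self_iff.2 rfl] at this
  obtain ⟨P, _, hPC, hP⟩ := hC.exists_measure h1
  let T : Measure (Fin d → ℝ) → (Fin d → I) → Fin d → ℝ :=
    fun κ u i => quantile (κ.map (fun z => z i)) (u i)
  have hT : ∀ κ, Measurable (T κ) := fun κ => by fun_prop
  have hTT : Measurable fun u => (T μ u, T ν u) := (hT μ).prodMk (hT ν)
  refine ⟨P.map fun u => (T μ u, T ν u), ⟨Measure.isProbabilityMeasure_map hTT.aemeasurable,
    ?_, ?_⟩, fun i => ?_⟩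
  · rw [Measure.map_map measurable_fst hTT]
    exact map_quantile_eq hP fun x => by rw [hPC, hμ]
  · rw [Measure.map_map measurable_snd hTT]
    exact map_quantile_eq hP fun x => by rw [hPC, hν]
  · simp_rw [coe_comonotonicityCopula_pair]
    have := hasJointCDF_map_quantile (hP i) (μ.map fun z => z i) (ν.map fun z => z i)
    rw [Measure.map_map (by fun_prop) (by fun_prop)] at this
    rw [Measure.map_map (by fun_prop) hTT]
    exact this

/-! ### Comparison of norms and proof of the main theorem -/

theorem sum_rpow_le_rpow_sum {ι : Type*} (s : Finset ι) {f : ι → ℝ} (hf : ∀ i, 0 ≤ f i) {r : ℝ}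
    (hr : 1 ≤ r) : ∑ i ∈ s, f i ^ r ≤ (∑ i ∈ s, f i) ^ r := by
  classical
  induction s using Finset.induction_on with
  | empty => simp [Real.zero_rpow (by linarith : r ≠ 0)]
  | insert a s ha ih =>
    rw [Finset.sum_insert ha, Finset.sum_insert ha]
    exact (add_le_add_right ih _).trans
      (Real.add_rpow_le_rpow_add (hf a) (Finset.sum_nonneg fun i _ => hf i) hr)

theorem qNorm_rpow {d : ℕ} {p q : ℝ} (hq : 0 < q) (x : Fin d → ℝ) :
    qNorm q x ^ p = (∑ i, |x i| ^ q) ^ (p / q) := by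
  have h : (ENNReal.ofReal q).toReal = q := ENNReal.toReal_ofReal hq.le
  rw [qNorm, PiLp.norm_eq_sum (by rwa [h]), h, ← Real.rpow_mul, one_div_mul_eq_div]
  · simp [Real.norm_eq_abs]
  · exact Finset.sum_nonneg fun i _ => Real.rpow_nonneg (norm_nonneg _) _

theorem sum_abs_rpow_le_qNorm_rpow {d : ℕ} {p q : ℝ} (hq : 0 < q) (hqp : q ≤ p)
    (x : Fin d → ℝ) : ∑ i, |x i| ^ p ≤ qNorm q x ^ p := by
  rw [qNorm_rpow hq]
  refine le_of_eq_of_le (Finset.sum_congr rfl fun i _ => ?_) (sum_rpow_le_rpow_sum _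
    (f := fun i => |x i| ^ q) (fun i => Real.rpow_nonneg (abs_nonneg _) _)
    ((one_le_div hq).2 hqp))
  rw [← Real.rpow_mul (abs_nonneg _), mul_div_cancel₀ _ hq.ne']

/-- The power mean inequality with exponent `p / q ≥ 1`. -/
theorem qNorm_rpow_le_const_mul_sum {d : ℕ} {p q : ℝ} (hq : 0 < q) (hqp : q ≤ p)
    (x : Fin d → ℝ) : qNorm q x ^ p ≤ (d : ℝ) ^ (p / q - 1) * ∑ i, |x i| ^ p := by
  rw [qNorm_rpow hq]
  refine (Real.rpow_sum_le_const_mul_sum_rpow_of_nonneg Finset.univ (f := fun i => |x i| ^ q)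
    ((one_le_div hq).2 hqp) fun i _ => Real.rpow_nonneg (abs_nonneg _) _).trans_eq ?_
  rw [Finset.card_univ, Fintype.card_fin]
  congr 1
  refine Finset.sum_congr rfl fun i _ => ?_
  rw [← Real.rpow_mul (abs_nonneg _), mul_div_cancel₀ _ hq.ne']

theorem sum_abs_rpow_eq_qNorm_rpow {d : ℕ} {p : ℝ} (hp : 0 < p) (x : Fin d → ℝ) :
    ∑ i, |x i| ^ p = qNorm p x ^ p := by
  rw [qNorm_rpow hp, div_self hp.ne', Real.rpow_one]

theorem qNorm_nonneg {d : ℕ} {q : ℝ} (hq : 0 < q) (x : Fin d → ℝ) : 0 ≤ qNorm q x := by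
  rw [← Real.rpow_one (qNorm q x), qNorm_rpow hq]
  exact Real.rpow_nonneg (Finset.sum_nonneg fun i _ => Real.rpow_nonneg (abs_nonneg _) _) _

theorem qNorm_rpow_le_sum {d : ℕ} {p q : ℝ} (hp : 0 < p) (hpq : p ≤ q) (x : Fin d → ℝ) :
    qNorm q x ^ p ≤ ∑ i, |x i| ^ p := by
  have hq := hp.trans_le hpq
  have h := sum_abs_rpow_le_qNorm_rpow hp hpq x
  rw [sum_abs_rpow_eq_qNorm_rpow hq, Real.rpow_le_rpow_iff (qNorm_nonneg hq x)
    (qNorm_nonneg hp x) hq] at h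
  rw [sum_abs_rpow_eq_qNorm_rpow hp]
  exact Real.rpow_le_rpow (qNorm_nonneg hq x) h hp.le

/-- The power mean bound with `p` and `q` exchanged, raised to the power `p / q`: its constant
becomes `d ^ (1 - p / q)`, which the prefactor cancels. -/
theorem const_mul_sum_le_qNorm_rpow {d : ℕ} {p q : ℝ} (hp : 0 < p) (hpq : p ≤ q)
    (x : Fin d → ℝ) : (d : ℝ) ^ (p / q - 1) * ∑ i, |x i| ^ p ≤ qNorm q x ^ p := by
  have hq := hp.trans_le hpq
  rcases Nat.eq_zero_or_pos d with rfl | hd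
  · simpa using Real.rpow_nonneg (qNorm_nonneg hq x) p
  have hd : (0 : ℝ) < d := Nat.cast_pos.2 hd
  have h := Real.rpow_le_rpow (Real.rpow_nonneg (qNorm_nonneg hp x) q)
    (qNorm_rpow_le_const_mul_sum hp hpq x) (div_nonneg hp.le hq.le)
  rw [sum_abs_rpow_eq_qNorm_rpow hq, Real.mul_rpow (Real.rpow_nonneg hd.le _)
    (Real.rpow_nonneg (qNorm_nonneg hq x) _), ← Real.rpow_mul (qNorm_nonneg hp x),
    ← Real.rpow_mul (qNorm_nonneg hq x), ← Real.rpow_mul hd.le, mul_div_cancel₀ _ hq.ne'] at h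
  rw [sum_abs_rpow_eq_qNorm_rpow hp]
  refine (mul_le_mul_of_nonneg_left h (Real.rpow_nonneg hd.le _)).trans_eq ?_
  rw [← mul_assoc, ← Real.rpow_add hd]
  have : p / q - 1 + (q / p - 1) * (p / q) = 0 := by
    field_simp
    ring
  rw [this, Real.rpow_zero, one_mul]

/-! ### Finiteness and minimality of the comonotone cost -/

theorem lintegral_ofReal_abs_rpow_lt_top_iff {X : Type*} [MeasurableSpace X] {μ : Measure X}
    {p : ℝ} (hp : 0 < p) {f : X → ℝ} :
    ∫⁻ x, ENNReal.ofReal (|f x| ^ p) ∂μ < ∞ ↔ eLpNorm f (ENNReal.ofReal p) μ < ∞ := by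
  rw [eLpNorm_lt_top_iff_lintegral_rpow_enorm_lt_top (by simpa using hp) ENNReal.ofReal_ne_top,
    ENNReal.toReal_ofReal hp.le]
  simp_rw [Real.enorm_eq_ofReal_abs, ENNReal.ofReal_rpow_of_nonneg (abs_nonneg _) hp.le]

theorem FiniteMoment.memLp {d : ℕ} {p : ℝ} (hp : 0 < p) {μ : Measure (Fin d → ℝ)}
    [IsFiniteMeasure μ] (h : FiniteMoment p μ) (i : Fin d) :
    MemLp (fun x => x i) (ENNReal.ofReal p) μ := by
  obtain ⟨x₀, hx₀⟩ := h
  have : MemLp (fun x => x₀ i - x i) (ENNReal.ofReal p) μ := by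
    refine ⟨(measurable_const.sub (measurable_pi_apply i)).aestronglyMeasurable,
      (lintegral_ofReal_abs_rpow_lt_top_iff hp).1 (lt_of_le_of_lt ?_ hx₀)⟩
    refine lintegral_mono fun x => ENNReal.ofReal_le_ofReal ?_
    rw [← sum_abs_rpow_eq_qNorm_rpow hp]
    exact Finset.single_le_sum (f := fun i => |(x₀ - x) i| ^ p)
      (fun i _ => Real.rpow_nonneg (abs_nonneg _) _) (Finset.mem_univ i)
  refine ((memLp_const (x₀ i)).sub this).ae_eq (.of_forall fun x => ?_)
  exact sub_sub_cancel (x₀ i) (x i)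

/-- By Minkowski: both coordinates are in `L^p` under any coupling, since this depends only on its
margins. -/
theorem lintegral_coordinate_lt_top {d : ℕ} {p : ℝ} (hp : 0 < p) {μ ν : Measure (Fin d → ℝ)}
    [IsFiniteMeasure μ] [IsFiniteMeasure ν] (hμ : FiniteMoment p μ) (hν : FiniteMoment p ν)
    {π : Measure ((Fin d → ℝ) × (Fin d → ℝ))} (hπ : π ∈ couplings μ ν) (i : Fin d) :
    ∫⁻ z, ENNReal.ofReal (|z.1 i - z.2 i| ^ p) ∂π < ∞ := by
  obtain ⟨_, h1, h2⟩ := hπ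
  have m1 := (hμ.memLp hp i).comp_measurePreserving (⟨measurable_fst, h1⟩ : MeasurePreserving _ π μ)
  have m2 := (hν.memLp hp i).comp_measurePreserving (⟨measurable_snd, h2⟩ : MeasurePreserving _ π ν)
  rw [lintegral_ofReal_abs_rpow_lt_top_iff hp]
  exact (m1.sub m2).2

theorem wassersteinDist_rpow {d : ℕ} {p : ℝ} (hp : 0 < p) (q : ℝ) (μ ν : Measure (Fin d → ℝ)) :
    wassersteinDist p q μ ν ^ p =
      ⨅ π ∈ couplings μ ν, ∫⁻ z, ENNReal.ofReal (qNorm q (z.1 - z.2) ^ p) ∂π := by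
  rw [wassersteinDist, ← ENNReal.rpow_mul, one_div_mul_cancel hp.ne', ENNReal.rpow_one]

theorem lintegral_ofReal_sum_abs_rpow {d : ℕ} (p : ℝ)
    (π : Measure ((Fin d → ℝ) × (Fin d → ℝ))) :
    ∫⁻ z, ENNReal.ofReal (∑ i, |(z.1 - z.2) i| ^ p) ∂π =
      ∑ i, ∫⁻ z, ENNReal.ofReal (|z.1 i - z.2 i| ^ p) ∂π := by
  rw [← lintegral_finsetSum _ fun i _ => by fun_prop]
  refine lintegral_congr fun z => ?_
  rw [ENNReal.ofReal_sum_of_nonneg fun i _ => Real.rpow_nonneg (abs_nonneg _) _]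
  rfl

theorem comonotoneCost_eq_lintegral {d : ℕ} (p : ℝ) {μ ν : Measure (Fin d → ℝ)}
    {π : Measure ((Fin d → ℝ) × (Fin d → ℝ))}
    (h : ∀ i, HasJointCDF (π.map fun z => (z.1 i, z.2 i))
      (fun x y => comonotonicityCopula ![marginCDF μ i x, marginCDF ν i y])) :
    comonotoneCost p μ ν = ∑ i, ∫⁻ z, ENNReal.ofReal (|z.1 i - z.2 i| ^ p) ∂π := by
  refine Finset.sum_congr rfl fun i _ => ?_
  rw [stieltjesMeasure_eq (h i), lintegral_map (by fun_prop) (by fun_prop)]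

/-- The Fréchet–Hoeffding upper bound: a quadrant lies in each of its two half-planes. -/
theorem measureReal_Iic_prod_Iic_le {d : ℕ} {μ ν : Measure (Fin d → ℝ)} [IsProbabilityMeasure μ]
    [IsProbabilityMeasure ν] {π : Measure ((Fin d → ℝ) × (Fin d → ℝ))} (hπ : π ∈ couplings μ ν)
    (i : Fin d) (x y : ℝ) :
    (π.map fun z => (z.1 i, z.2 i)).real (Iic x ×ˢ Iic y) ≤
      comonotonicityCopula ![marginCDF μ i x, marginCDF ν i y] := by
  obtain ⟨_, h1, h2⟩ := hπ
  have hp : ∀ κ : Measure (Fin d → ℝ), IsProbabilityMeasure κ →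
      IsProbabilityMeasure (κ.map fun z => z i) := fun κ _ =>
    Measure.isProbabilityMeasure_map (measurable_pi_apply i).aemeasurable
  have := hp μ inferInstance
  have := hp ν inferInstance
  rw [coe_comonotonicityCopula_pair, marginCDF, marginCDF]
  simp only [cdf_eq_real]
  rw [map_measureReal_apply (by fun_prop) (measurableSet_Iic.prod measurableSet_Iic),
    map_measureReal_apply (by fun_prop) measurableSet_Iic,
    map_measureReal_apply (by fun_prop) measurableSet_Iic, ← h1, ← h2,
    map_measureReal_apply (by fun_prop) (measurableSet_Iic.preimage (by fun_prop)),
    map_measureReal_apply (by fun_prop) (measurableSet_Iic.preimage (by fun_prop))]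
  exact le_min (measureReal_mono fun z hz => hz.1) (measureReal_mono fun z hz => hz.2)

theorem comonotoneCost_le_lintegral {d : ℕ} {p : ℝ} (hp : 1 ≤ p) {μ ν : Measure (Fin d → ℝ)}
    [IsProbabilityMeasure μ] [IsProbabilityMeasure ν] (hC : ShareCopula μ ν)
    {π : Measure ((Fin d → ℝ) × (Fin d → ℝ))} (hπ : π ∈ couplings μ ν) :
    comonotoneCost p μ ν ≤ ∑ i, ∫⁻ z, ENNReal.ofReal (|z.1 i - z.2 i| ^ p) ∂π := by
  obtain ⟨γ, hγ, hγM⟩ := hC.exists_coupling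
  rw [comonotoneCost_eq_lintegral p hγM]
  refine Finset.sum_le_sum fun i _ => ?_
  have hpair : Measurable fun z : (Fin d → ℝ) × (Fin d → ℝ) => (z.1 i, z.2 i) := by fun_prop
  have hmap : ∀ κ : Measure ((Fin d → ℝ) × (Fin d → ℝ)),
      ∫⁻ z, ENNReal.ofReal (|z.1 i - z.2 i| ^ p) ∂κ =
        ∫⁻ w, ENNReal.ofReal (|w.1 - w.2| ^ p) ∂(κ.map fun z => (z.1 i, z.2 i)) := fun κ => by
    rw [lintegral_map (by fun_prop) hpair]
  have hfst : ∀ κ ∈ couplings μ ν,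
      (κ.map fun z => (z.1 i, z.2 i)).map Prod.fst = μ.map fun z => z i := fun κ hκ => by
    rw [← hκ.2.1, Measure.map_map measurable_fst hpair,
      Measure.map_map (measurable_pi_apply i) measurable_fst]
    rfl
  have hsnd : ∀ κ ∈ couplings μ ν,
      (κ.map fun z => (z.1 i, z.2 i)).map Prod.snd = ν.map fun z => z i := fun κ hκ => by
    rw [← hκ.2.2, Measure.map_map measurable_snd hpair,
      Measure.map_map (measurable_pi_apply i) measurable_snd]
    rfl
  have := hγ.1
  have := hπ.1
  rw [hmap γ, hmap π]
  refine lintegral_abs_sub_rpow_le hp ((hfst γ hγ).trans (hfst π hπ).symm)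
    ((hsnd γ hγ).trans (hsnd π hπ).symm) fun x y => ?_
  rw [← ENNReal.toReal_le_toReal (measure_ne_top _ _) (measure_ne_top _ _)]
  exact (measureReal_Iic_prod_Iic_le hπ i x y).trans_eq ((hγM i).2 x y).symm

theorem proposition3p6 (d : ℕ) (p q : ℝ) (hp : 1 ≤ p) (hq : 1 ≤ q) (hqp : q ≠ p)
    (μ ν : Measure (Fin d → ℝ)) [IsProbabilityMeasure μ] [IsProbabilityMeasure ν]
    (hμ : FiniteMoment p μ) (hν : FiniteMoment p ν) (hC : ShareCopula μ ν) :
    comonotoneCost p μ ν < ∞ ∧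
    (q ≤ p →
      comonotoneCost p μ ν ≤ wassersteinDist p q μ ν ^ p ∧
      wassersteinDist p q μ ν ^ p ≤
        ENNReal.ofReal ((d : ℝ) ^ (p / q - 1)) * comonotoneCost p μ ν) ∧
    (p ≤ q →
      ENNReal.ofReal ((d : ℝ) ^ (p / q - 1)) * comonotoneCost p μ ν ≤
        wassersteinDist p q μ ν ^ p ∧
      wassersteinDist p q μ ν ^ p ≤ comonotoneCost p μ ν) := by
  have hp0 : 0 < p := by linarith
  have hq0 : 0 < q := by linarith
  have hc : 0 ≤ (d : ℝ) ^ (p / q - 1) := Real.rpow_nonneg d.cast_nonneg _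
  obtain ⟨γ, hγ, hγM⟩ := hC.exists_coupling
  have hγS := comonotoneCost_eq_lintegral p hγM
  have hconst : ∀ π : Measure ((Fin d → ℝ) × (Fin d → ℝ)),
      ENNReal.ofReal ((d : ℝ) ^ (p / q - 1)) *
        ∑ i, ∫⁻ z, ENNReal.ofReal (|z.1 i - z.2 i| ^ p) ∂π =
      ∫⁻ z, ENNReal.ofReal ((d : ℝ) ^ (p / q - 1) * ∑ i, |(z.1 - z.2) i| ^ p) ∂π := by
    intro π
    rw [← lintegral_ofReal_sum_abs_rpow, ← lintegral_const_mul' _ _ ENNReal.ofReal_ne_top]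
    simp_rw [ENNReal.ofReal_mul hc]
  rw [wassersteinDist_rpow hp0]
  refine ⟨?_, fun hle => ⟨le_iInf₂ fun π hπ => ?_, ?_⟩, fun hle => ⟨le_iInf₂ fun π hπ => ?_, ?_⟩⟩
  · rw [hγS]
    exact ENNReal.sum_lt_top.2 fun i _ => lintegral_coordinate_lt_top hp0 hμ hν hγ i
  · refine (comonotoneCost_le_lintegral hp hC hπ).trans ?_
    rw [← lintegral_ofReal_sum_abs_rpow]
    exact lintegral_mono fun z =>
      ENNReal.ofReal_le_ofReal (sum_abs_rpow_le_qNorm_rpow hq0 hle _)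
  -- The comonotone coupling is the competitor in both upper bounds.
  · refine (iInf₂_le γ hγ).trans ?_
    rw [hγS, hconst]
    exact lintegral_mono fun z =>
      ENNReal.ofReal_le_ofReal (qNorm_rpow_le_const_mul_sum hq0 hle _)
  · refine (mul_le_mul_right (comonotoneCost_le_lintegral hp hC hπ) _).trans ?_
    rw [hconst]
    exact lintegral_mono fun z =>
      ENNReal.ofReal_le_ofReal (const_mul_sum_le_qNorm_rpow hp0 hle _)
  · refine (iInf₂_le γ hγ).trans ?_
    rw [hγS, ← lintegral_ofReal_sum_abs_rpow]
    exact lintegral_mono fun z => ENNReal.ofReal_le_ofReal (qNorm_rpow_le_sum hp0 hle _)
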